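/- **Setting.** A *task* is a function $f:[0,1]\to\mathbb R$. A *ReLU network* is a fully connected network (affine layers of arbitrary finite widths and depth, ReLU applied coordinatewise after every layer except the last); its number of weights is the number of nonzero entries of all its weight matrices and bias vectors. A *(general) in-context learner* $\Psi$ with sample budget $N$ consists of fixed points $x_1,\dots,x_N\in[0,1]$ and an arbitrary predictor $\widehat F:([0,1]\times\mathbb R)^N\times[0,1]\to\mathbb R$, and outputs $\Psi(f)(x)=\widehat F(((x_i,f(x_i)))_{i\le N},x)$. A *(general) agentic learner* with query budget $N$ consists of a point $x_1\in[0,1]$, arbitrary query maps $q_n:([0,1]\times\mathbb R)^{n-1}\to[0,1]$ for $2\le n\le N$, and an arbitrary predictor $\widehat F$ as before; on a task $f$ it queries $x_1(f)=x_1$, $x_n(f)=q_n(((x_i(f),f(x_i(f))))_{i<n})$, and outputs $\Psi(f)(x)=\widehat F(((x_i(f),f(x_i(f))))_{i\le N},x)$. Its first $N-1$ queries are *fixed* if $q_2,\dots,q_{N-1}$ are constant. The *worst-case error* of $\Psi$ on a family $\mathcal T$ of tasks is $\sup_{f\in\mathcal T}\sup_{x\in[0,1]}|\Psi(f)(x)-f(x)|\in[0,\infty]$.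 For budgets $N,m$ let $\mathrm{IC_G}$, $\mathrm{A_G}$ be the classes of all in-context, respectively agentic, learners with budget $N$; let $\mathrm{IC_R}$ be the class of in-context learners with budget $N$ whose predictor is a ReLU network with at most $m$ weights, and $\mathrm{A_R}$ the class of agentic learners with budget $N$ whose query maps and predictor are ReLU networks with at most $m$ weights each. On a family $\mathcal T$, write $\mathsf R_1\le\mathsf R_2$ if for every $\Psi_1\in\mathsf R_1$ there is $\Psi_2\in\mathsf R_2$ whose worst-case error on $\mathcal T$ is at most that of $\Psi_1$; $\mathsf R_1=\mathsf R_2$ if both $\mathsf R_1\le\mathsf R_2$ and $\mathsf R_2\le\mathsf R_1$; and $\mathsf R_1<\mathsf R_2$ if $\mathsf R_1\le\mathsf R_2$ but not $\mathsf R_2\le\mathsf R_1$. **The address-spike family.** Let $N\ge3$, $m\in\mathbb N$ and $0<\delta<1/(6N)$. Put $h_a(x)=(1-|x-a|/\delta)_+$, $q_i=\frac{i-1}{2(N-1)}$ for $1\le i\le N-1$, $\tau(t)=2\min\{t,1-t\}$, and $\widehat s=(\tau(s_1),\dots,\tau(s_{N-1}))$ for $s\in[0,1]^{N-1}$. Call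 $g:[0,1]^{N-1}\to[2/3,1]$ *admissible* if it is continuous and surjective and every ReLU network with at most $m$ weights has uniform distance at least $1/6$ from $g$ on $[0,1]^{N-1}$. For admissible $g$ let $q^\ast(s)=g(\widehat s)$ and let $\mathcal T_g$ be the family of all $$f_{s,\beta}=\sum_{i=1}^{N-1}s_ih_{q_i}+\beta\,h_{q^\ast(s)},\qquad s\in[0,1]^{N-1},\ \beta\in\{0,1\}.$$ **Theorem.** Let $N\ge3$, $m\in\mathbb N$ and $0<\delta<1/(6N)$. (a) For every admissible $g$: * (i) there is a general agentic learner with query budget $N$, whose first $N-1$ queries are fixed and whose last query is adaptive, that reconstructs every task in $\mathcal T_g$ exactly; * (ii) every in-context learner with sample budget $N$ has worst-case error at least $1/2$ on $\mathcal T_g$; * (iii$'$) every agentic learner with query budget $N$ whose first $N-1$ queries are fixed, and whose query maps are ReLU networks with at most $m$ weights each, has worst-case error at least $1/2$ on $\mathcal T_g$; * consequently $\mathrm{IC_G}<\mathrm{A_G}$ on $\mathcal T_g$. (b) An admissible $g=g_m$ can be chosen such that moreover * (iii) every agentic learner with query budget $N$ whose query maps are ReLU networks with at most $m$ weights each has worst-case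 error at least $1/2$ on $\mathcal T_{g}$; * consequently $\mathrm{IC_R}=\mathrm{A_R}$ on $\mathcal T_{g}$. In (iii) and (iii$'$) the final predictor is arbitrary. In particular, for the $g_m$ of (b), all of (i), (ii), (iii), $\mathrm{IC_G}<\mathrm{A_G}$ and $\mathrm{IC_R}=\mathrm{A_R}$ hold on $\mathcal T^{\mathrm{addr}}_{N,m}=\mathcal T_{g_m}$. -/

import Mathlib

open scoped ENNReal unitInterval

noncomputable section

/-! ### ReLU networks -/

/-- Fully connected ReLU networks with input dimension `d` and output dimension `e`, given by their
parameters: a final affine map, preceded by any finite number of hidden layers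
`x ↦ ReLU (A x + b)` of arbitrary widths. -/
inductive ReLUNet : ℕ → ℕ → Type
  | output {d e : ℕ} (A : Matrix (Fin e) (Fin d) ℝ) (b : Fin e → ℝ) : ReLUNet d e
  | hidden {d k e : ℕ} (A : Matrix (Fin k) (Fin d) ℝ) (b : Fin k → ℝ) (Φ : ReLUNet k e) :
      ReLUNet d e

namespace ReLUNet

/-- The function realized by a network. -/
def eval : {d e : ℕ} → ReLUNet d e → (Fin d → ℝ) → (Fin e → ℝ)
  | _, _, output A b, x => fun i => A.mulVec x i + b i
  | _, _, hidden A b Φ, x => Φ.eval (fun i => max (A.mulVec x i + b i) 0)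

/-- The number of nonzero entries of a weight matrix and of a bias vector. -/
def layerSize {d e : ℕ} (A : Matrix (Fin e) (Fin d) ℝ) (b : Fin e → ℝ) : ℕ :=
  Set.ncard {p : Fin e × Fin d | A p.1 p.2 ≠ 0} + Set.ncard {i : Fin e | b i ≠ 0}

/-- The size (number of weights) of a network: the number of its nonzero parameters. -/
def size : {d e : ℕ} → ReLUNet d e → ℕ
  | _, _, output A b => layerSize A b
  | _, _, hidden A b Φ => layerSize A b + Φ.size

end ReLUNet

/-! ### Learners -/

/-- A context of `n` samples `(xᵢ, f xᵢ)`, in order. -/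
abbrev Context (X : Type*) (n : ℕ) : Type _ := Fin n → X × ℝ

/-- A general in-context learner with sample budget `N`. -/
structure ICLearner (X : Type*) (N : ℕ) where
  /-- the fixed query points -/
  point : Fin N → X
  /-- the predictor -/
  predictor : Context X N → X → ℝ

/-- The output of an in-context learner on a task. -/
def ICLearner.output {X : Type*} {N : ℕ} (Ψ : ICLearner X N) (f : X → ℝ) : X → ℝ :=
  Ψ.predictor (fun i => (Ψ.point i, f (Ψ.point i)))

/-- A general agentic learner with query budget `N`. The map `query k` chooses the query point
number `k + 2` from the first `k + 1` samples; only those with `k + 2 ≤ N` are ever used. -/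
structure Agent (X : Type*) (N : ℕ) where
  /-- the initial query point -/
  first : X
  /-- the adaptive query maps -/
  query : (k : ℕ) → Context X (k + 1) → X
  /-- the final predictor -/
  predictor : Context X N → X → ℝ

namespace Agent

variable {X : Type*} {N : ℕ}

/-- The query point number `n + 1`, given the context of the first `n` samples. -/
def next (Ψ : Agent X N) : (n : ℕ) → Context X n → X
  | 0, _ => Ψ.first
  | k + 1, c => Ψ.query k c

/-- The context of the first `n` samples that the learner gathers from the task `f`. -/
def context (Ψ : Agent X N) (f : X → ℝ) : (n : ℕ) → Context X n
  | 0 => Fin.elim0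
  | n + 1 =>
      Fin.snoc (α := fun _ => X × ℝ) (Ψ.context f n)
        (Ψ.next n (Ψ.context f n), f (Ψ.next n (Ψ.context f n)))

/-- The output of an agentic learner on a task. -/
def output (Ψ : Agent X N) (f : X → ℝ) : X → ℝ :=
  Ψ.predictor (Ψ.context f N)

/-- All queries except the last one, number `N`, are fixed: their query maps are constant. -/
def FixedButLast (Ψ : Agent X N) : Prop :=
  ∀ k : ℕ, k + 2 < N → ∀ c c' : Context X (k + 1), Ψ.query k c = Ψ.query k c'

end Agent

/-! ### Realizability on the domain `[0,1]` -/

/-- A context over `[0,1]` as a vector of real numbers, `(x₁, …, xₙ, y₁, …, yₙ)`. -/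
def Context.vec {n : ℕ} (c : Context I n) : Fin (n + n) → ℝ :=
  Fin.append (fun i => ((c i).1 : ℝ)) (fun i => (c i).2)

/-- A predictor is implemented by a ReLU network with at most `m` weights. -/
def PredictorRealizable {N : ℕ} (m : ℕ) (F : Context I N → I → ℝ) : Prop :=
  ∃ Φ : ReLUNet (N + N + 1) 1, Φ.size ≤ m ∧
    ∀ (c : Context I N) (x : I),
      F c x = Φ.eval (Fin.snoc (α := fun _ => ℝ) c.vec (x : ℝ)) 0

/-- The query maps of an agentic learner are implemented by ReLU networks, each with at most `m`
weights. -/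
def Agent.QueriesRealizable {N : ℕ} (m : ℕ) (Ψ : Agent I N) : Prop :=
  ∀ k : ℕ, k + 2 ≤ N → ∃ Φ : ReLUNet ((k + 1) + (k + 1)) 1, Φ.size ≤ m ∧
    ∀ c : Context I (k + 1), (Ψ.query k c : ℝ) = Φ.eval c.vec 0

/-! ### Worst-case errors, regimes and their comparison -/

/-- The worst-case uniform error on the family `T` of a learner with output map `P`. -/
def worstError {X : Type*} (T : Set (X → ℝ)) (P : (X → ℝ) → X → ℝ) : ℝ≥0∞ :=
  ⨆ f ∈ T, ⨆ x : X, ‖P f x - f x‖ₑ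

/-- A regime, given by the output maps `f ↦ Ψ(f)` of its learners. -/
abbrev Regime (X : Type*) : Type _ := Set ((X → ℝ) → X → ℝ)

/-- General in-context learners with sample budget `N`. -/
def ICG (N : ℕ) : Regime I := {P | ∃ Ψ : ICLearner I N, P = Ψ.output}

/-- General agentic learners with query budget `N`. -/
def AG (N : ℕ) : Regime I := {P | ∃ Ψ : Agent I N, P = Ψ.output}

/-- ReLU-realizable in-context learners with sample budget `N` and weight budget `m`. -/
def ICR (N m : ℕ) : Regime I :=
  {P | ∃ Ψ : ICLearner I N, PredictorRealizable m Ψ.predictor ∧ P = Ψ.output}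

/-- ReLU-realizable agentic learners with query budget `N` and weight budget `m`: each of the
networks for the query maps and the predictor has at most `m` weights. -/
def AR (N m : ℕ) : Regime I :=
  {P | ∃ Ψ : Agent I N, Ψ.QueriesRealizable m ∧ PredictorRealizable m Ψ.predictor ∧ P = Ψ.output}

/-- `R₁ ≤ R₂` on the family `T`: every learner in `R₁` is matched by one in `R₂`. -/
def RegimeLE {X : Type*} (T : Set (X → ℝ)) (R₁ R₂ : Regime X) : Prop :=
  ∀ P₁ ∈ R₁, ∃ P₂ ∈ R₂, worstError T P₂ ≤ worstError T P₁

/-- `R₁ = R₂` on the family `T`. -/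
def RegimeEq {X : Type*} (T : Set (X → ℝ)) (R₁ R₂ : Regime X) : Prop :=
  RegimeLE T R₁ R₂ ∧ RegimeLE T R₂ R₁

/-- `R₁ < R₂` on the family `T`. -/
def RegimeLT {X : Type*} (T : Set (X → ℝ)) (R₁ R₂ : Regime X) : Prop :=
  RegimeLE T R₁ R₂ ∧ ¬ RegimeLE T R₂ R₁

/-! ### The address-spike family -/

/-- The hat function of height `1` and half-width `δ` centred at `a`. -/
def hat (δ a x : ℝ) : ℝ := max (1 - |x - a| / δ) 0

/-- The static points `q₁, …, q_{N-1}`, indexed from `0`. -/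
def staticPoint (N : ℕ) (i : Fin (N - 1)) : ℝ := (i : ℝ) / (2 * ((N : ℝ) - 1))

/-- The tent map `τ`, applied to each coordinate. -/
def tent {n : ℕ} (s : Fin n → ℝ) : Fin n → ℝ := fun i => 2 * min (s i) (1 - s i)

/-- Admissible address maps `g : [0,1]ⁿ → [2/3,1]`: continuous, surjective, and at uniform distance
at least `1/6` from every ReLU network with at most `m` weights. -/
structure IsHardAddressMap (n m : ℕ) (g : (Fin n → ℝ) → ℝ) : Prop where
  continuousOn : ContinuousOn g (Set.Icc 0 1)
  image_eq : g '' Set.Icc 0 1 = Set.Icc (2 / 3) 1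
  hard : ∀ Φ : ReLUNet n 1, Φ.size ≤ m →
    1 / 6 ≤ ⨆ u ∈ Set.Icc (0 : Fin n → ℝ) 1, ‖Φ.eval u 0 - g u‖ₑ

/-- The address-spike task with coefficients `s`, hidden bit `β` and moving spike at
`g (tent s)`. -/
def addrTask (N : ℕ) (δ : ℝ) (g : (Fin (N - 1) → ℝ) → ℝ) (s : Fin (N - 1) → ℝ) (β : ℝ) : I → ℝ :=
  fun x => ∑ i, s i * hat δ (staticPoint N i) x + β * hat δ (g (tent s)) x

/-- The address-spike family. -/
def addrFamily (N : ℕ) (δ : ℝ) (g : (Fin (N - 1) → ℝ) → ℝ) : Set (I → ℝ) :=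
  {f | ∃ s ∈ Set.Icc (0 : Fin (N - 1) → ℝ) 1, ∃ β ∈ ({0, 1} : Set ℝ), f = addrTask N δ g s β}

end

/-!
A task of the family carries `N` numbers, the static coefficients `s j` and the hidden bit `β`, in
spikes with pairwise disjoint supports, and a learner has `N` queries. An agentic learner reads all
the `s j`, computes the address and reads `β` there (`exactAgent`). Non-adaptive queries miss the
moving spike for some `s`, since `N` intervals of length `2 δ` do not cover `[2/3, 1]`
(`half_le_worstError_ICLearner`).

For an agentic learner with error below `1 / 2`, consider its runs on the spike-free tasks `β = 0`.
If some run visited no point of one of the `N` spikes, changing the coefficient of that spike from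
`0` to `1` would go unnoticed. So every run visits every spike, each exactly once. When the query
maps are continuous, the order of the visits cannot change over the connected cube of coefficients
(`exists_schedule`). In particular one fixed query finds the address for all `s`.

* If only the last query is adaptive, it must be this one. The earlier queries are fixed and each
  sample value is a multiple of a single `s j`; substituting this into the query network does not
  increase the number of weights (`ReLUNet.exists_reparam`). As `tent (u / 2) = u`, the result is a
  network with at most `m` weights at distance at most `δ < 1 / 6` from `g`, contrary to the
  hardness of `g`.
* In general, the query before the one that finds the address reads some `s j` for the first time.
  When only `s j` varies, the samples move along a line, and the query is a ReLU network with at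
  most `m` weights along a line. It is affine on an interval of length `2 ^ (-m)`
  (`ReLUNet.exists_affine_eval`): each nonzero weight costs at most one halving. So it cannot follow
  an address map that oscillates faster than that in every coordinate, such as `waveAddress`, which
  for the same reason is admissible.

For that address map both realizable regimes have optimal error `1 / 2`, attained by the constant
`1 / 2`, as soon as one weight is allowed; without weights all their predictors vanish.
-/

/-! ### ReLU networks: reparametrization and restriction to lines -/

namespace ReLUNet

lemma continuous_eval {d e : ℕ} (Φ : ReLUNet d e) : Continuous Φ.eval := by
  induction Φ with
  | output A b =>
    refine continuous_pi fun i => ?_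
    exact ((continuous_apply i).comp (continuous_const.matrix_mulVec continuous_id)).add_const _
  | hidden A b Φ ih =>
    refine ih.comp (continuous_pi fun i => ?_)
    exact (((continuous_apply i).comp
      (continuous_const.matrix_mulVec continuous_id)).add_const _).max continuous_const

/-- Feeding an affine layer with inputs that are either constants or multiples of single new
variables does not increase its size: constants are absorbed in the bias, and columns are scaled
and merged. -/
lemma exists_layer_reparam {d e n : ℕ} (A : Matrix (Fin e) (Fin d) ℝ) (b : Fin e → ℝ)
    (p w : Fin d → ℝ) (idx : Fin d → Fin n) (h : ∀ i, p i = 0 ∨ w i = 0) :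
    ∃ (A' : Matrix (Fin e) (Fin n) ℝ) (b' : Fin e → ℝ), layerSize A' b' ≤ layerSize A b ∧
      ∀ u r, A'.mulVec u r + b' r = A.mulVec (fun i => p i + w i * u (idx i)) r + b r := by
  classical
  refine ⟨fun r l => ∑ i, if idx i = l then A r i * w i else 0, fun r => b r + ∑ i, A r i * p i,
    ?_, ?_⟩
  · set Sw : Set (Fin e × Fin d) := {q | A q.1 q.2 ≠ 0 ∧ w q.2 ≠ 0} with hSw
    set Sp : Set (Fin e × Fin d) := {q | A q.1 q.2 ≠ 0 ∧ p q.2 ≠ 0} with hSp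
    have h1 : Set.ncard {q : Fin e × Fin n |
        (∑ i, if idx i = q.2 then A q.1 i * w i else 0) ≠ 0} ≤ Sw.ncard := by
      refine (Set.ncard_le_ncard (t := (fun q : Fin e × Fin d => (q.1, idx q.2)) '' Sw) ?_
        (Set.toFinite _)).trans (Set.ncard_image_le (Set.toFinite _))
      rintro ⟨r, l⟩ hq
      obtain ⟨i, -, hi⟩ := Finset.exists_ne_zero_of_sum_ne_zero hq
      have hl : idx i = l := by
        by_contra hne
        exact hi (if_neg hne)
      rw [if_pos hl] at hi
      exact ⟨(r, i), ⟨left_ne_zero_of_mul hi, right_ne_zero_of_mul hi⟩, by simp [hl]⟩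
    have h2 : Set.ncard {r : Fin e | b r + ∑ i, A r i * p i ≠ 0} ≤
        Sp.ncard + Set.ncard {r : Fin e | b r ≠ 0} := by
      refine (Set.ncard_le_ncard (t := Prod.fst '' Sp ∪ {r : Fin e | b r ≠ 0}) ?_
        (Set.toFinite _)).trans ((Set.ncard_union_le _ _).trans
          (Nat.add_le_add_right (Set.ncard_image_le (Set.toFinite _)) _))
      intro r hr
      by_cases hb : b r = 0
      · left
        have hr' : ∑ i, A r i * p i ≠ 0 := by
          intro h0
          exact hr (by rw [hb, h0, add_zero])
        obtain ⟨i, -, hi⟩ := Finset.exists_ne_zero_of_sum_ne_zero hr'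
        exact ⟨(r, i), ⟨left_ne_zero_of_mul hi, right_ne_zero_of_mul hi⟩, rfl⟩
      · exact Or.inr hb
    have h3 : Sw.ncard + Sp.ncard ≤ Set.ncard {q : Fin e × Fin d | A q.1 q.2 ≠ 0} := by
      rw [← Set.ncard_union_eq ?_ (Set.toFinite _) (Set.toFinite _)]
      · exact Set.ncard_le_ncard (by rintro q (hq | hq) <;> exact hq.1) (Set.toFinite _)
      · rw [Set.disjoint_left]
        intro q hq hq'
        exact (h q.2).elim hq'.2 hq.2
    simp only [layerSize]
    omega
  · intro u r
    have h1 : ∑ l, (∑ i, if idx i = l then A r i * w i else 0) * u l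
        = ∑ i, A r i * w i * u (idx i) := by
      simp_rw [Finset.sum_mul]
      rw [Finset.sum_comm]
      refine Finset.sum_congr rfl fun i _ => ?_
      simp [ite_mul]
    simp only [Matrix.mulVec, dotProduct]
    rw [h1, add_comm (b r), ← add_assoc, ← Finset.sum_add_distrib]
    congr 1
    exact Finset.sum_congr rfl fun i _ => by ring

lemma exists_reparam {d e n : ℕ} (Φ : ReLUNet d e) (p w : Fin d → ℝ) (idx : Fin d → Fin n)
    (h : ∀ i, p i = 0 ∨ w i = 0) :
    ∃ Φ' : ReLUNet n e, Φ'.size ≤ Φ.size ∧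
      ∀ u, Φ'.eval u = Φ.eval (fun i => p i + w i * u (idx i)) := by
  cases Φ with
  | output A b =>
    obtain ⟨A', b', hs, he⟩ := exists_layer_reparam A b p w idx h
    exact ⟨.output A' b', hs, fun u => funext fun r => he u r⟩
  | hidden A b Φ =>
    obtain ⟨A', b', hs, he⟩ := exists_layer_reparam A b p w idx h
    refine ⟨.hidden A' b' Φ, Nat.add_le_add_right hs _, fun u => ?_⟩
    simp only [eval, he]

/-- Finitely many affine functions on an interval keep their signs on a subinterval: each function
costs a halving. -/
lemma exists_subinterval_sign {ι : Type*} (S : Finset ι) (α β : ι → ℝ) (a : ℝ) {L : ℝ}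
    (hL : 0 ≤ L) :
    ∃ a', a ≤ a' ∧ a' + L ≤ a + 2 ^ S.card * L ∧
      ∀ i ∈ S, (∀ t ∈ Set.Icc a' (a' + L), 0 ≤ α i + t * β i) ∨
        (∀ t ∈ Set.Icc a' (a' + L), α i + t * β i ≤ 0) := by
  classical
  induction S using Finset.induction_on generalizing a with
  | empty => exact ⟨a, le_rfl, by simp, by simp⟩
  | insert i S hi ih =>
    set K : ℝ := 2 ^ S.card * L with hK
    have hK0 : 0 ≤ K := by positivity
    have hcard : (2 : ℝ) ^ (insert i S).card * L = 2 * K := by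
      rw [Finset.card_insert_of_notMem hi, pow_succ, hK]; ring
    rw [hcard]
    obtain ⟨c, hc, hc', hsign⟩ : ∃ c, a ≤ c ∧ c + K ≤ a + 2 * K ∧
        ((∀ t ∈ Set.Icc c (c + K), 0 ≤ α i + t * β i) ∨
          (∀ t ∈ Set.Icc c (c + K), α i + t * β i ≤ 0)) := by
      rcases le_total 0 (α i + (a + K) * β i) with h0 | h0 <;>
        rcases le_total 0 (β i) with h1 | h1
      · exact ⟨a + K, by linarith, by linarith, Or.inl fun t ht => by nlinarith [ht.1, ht.2]⟩
      · exact ⟨a, le_rfl, by linarith, Or.inl fun t ht => by nlinarith [ht.1, ht.2]⟩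
      · exact ⟨a, le_rfl, by linarith, Or.inr fun t ht => by nlinarith [ht.1, ht.2]⟩
      · exact ⟨a + K, by linarith, by linarith, Or.inr fun t ht => by nlinarith [ht.1, ht.2]⟩
    obtain ⟨a', h1, h2, h3⟩ := ih c
    have hsub : Set.Icc a' (a' + L) ⊆ Set.Icc c (c + K) := Set.Icc_subset_Icc h1 h2
    refine ⟨a', hc.trans h1, h2.trans hc', fun j hj => ?_⟩
    rcases Finset.mem_insert.mp hj with rfl | hj
    · exact hsign.imp (fun h t ht => h t (hsub ht)) (fun h t ht => h t (hsub ht))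
    · exact h3 j hj

lemma mulVec_line {d e : ℕ} (A : Matrix (Fin e) (Fin d) ℝ) (b : Fin e → ℝ) (p v : Fin d → ℝ)
    (t : ℝ) (r : Fin e) :
    A.mulVec (p + t • v) r + b r = (A.mulVec p r + b r) + t * A.mulVec v r := by
  rw [Matrix.mulVec_add, Matrix.mulVec_smul]
  simp only [Pi.add_apply, Pi.smul_apply, smul_eq_mul]
  ring

/-- Only rows with a nonzero weight can break the linearity of a layer along a line. -/
lemma exists_affine_layer {d k : ℕ} (A : Matrix (Fin k) (Fin d) ℝ) (b : Fin k → ℝ)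
    (p v : Fin d → ℝ) (a : ℝ) {L : ℝ} (hL : 0 ≤ L) :
    ∃ a', a ≤ a' ∧ a' + L ≤ a + 2 ^ layerSize A b * L ∧ ∃ p' v' : Fin k → ℝ,
      ∀ t ∈ Set.Icc a' (a' + L),
        (fun r => max (A.mulVec (p + t • v) r + b r) 0) = p' + t • v' := by
  classical
  set S : Finset (Fin k) := Finset.univ.filter fun r => ∃ j, A r j ≠ 0 with hS
  have hcard : S.card ≤ layerSize A b := by
    refine le_trans ?_ (Nat.le_add_right _ _)
    rw [← Set.ncard_coe_finset]
    refine (Set.ncard_le_ncard (t := Prod.fst '' {q : Fin k × Fin d | A q.1 q.2 ≠ 0}) ?_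
      (Set.toFinite _)).trans (Set.ncard_image_le (Set.toFinite _))
    intro r hr
    obtain ⟨j, hj⟩ : ∃ j, A r j ≠ 0 := by simpa [hS] using hr
    exact ⟨(r, j), hj, rfl⟩
  obtain ⟨a', h1, h2, h3⟩ := exists_subinterval_sign S (fun r => A.mulVec p r + b r)
    (fun r => A.mulVec v r) a hL
  refine ⟨a', h1, h2.trans ?_, ?_⟩
  · have : (2 : ℝ) ^ S.card ≤ 2 ^ layerSize A b := pow_le_pow_right₀ (by norm_num) hcard
    nlinarith
  · have key : ∀ r, ∃ p' v' : ℝ, ∀ t ∈ Set.Icc a' (a' + L),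
        max (A.mulVec (p + t • v) r + b r) 0 = p' + t * v' := by
      intro r
      simp_rw [mulVec_line]
      by_cases hr : r ∈ S
      · rcases h3 r hr with h | h
        · exact ⟨A.mulVec p r + b r, A.mulVec v r, fun t ht => max_eq_left (h t ht)⟩
        · exact ⟨0, 0, fun t ht => by rw [max_eq_right (h t ht)]; ring⟩
      · have h0 : A.mulVec v r = 0 := by
          show ∑ j, A r j * v j = 0
          refine Finset.sum_eq_zero fun j _ => ?_
          have : A r j = 0 := by
            by_contra hj
            exact hr (by simpa [hS] using ⟨j, hj⟩)
          simp [this]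
        exact ⟨max (A.mulVec p r + b r) 0, 0, fun t _ => by simp [h0]⟩
    choose p' v' h using key
    exact ⟨p', v', fun t ht => funext fun r => h r t ht⟩

/-- Along a line, a network with `w` weights is affine on some interval of length `L` inside any
given interval of length `2 ^ w * L`, whatever its depth and widths. -/
lemma exists_affine_eval {d e : ℕ} (Φ : ReLUNet d e) (p v : Fin d → ℝ) (a : ℝ) {L : ℝ}
    (hL : 0 ≤ L) :
    ∃ a', a ≤ a' ∧ a' + L ≤ a + 2 ^ Φ.size * L ∧ ∃ p' v' : Fin e → ℝ,
      ∀ t ∈ Set.Icc a' (a' + L), Φ.eval (p + t • v) = p' + t • v' := by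
  induction Φ generalizing a with
  | output A b =>
    refine ⟨a, le_rfl, ?_, fun r => A.mulVec p r + b r, A.mulVec v, fun t _ => ?_⟩
    · have : (1 : ℝ) ≤ 2 ^ (output A b).size := one_le_pow₀ (by norm_num)
      nlinarith
    · exact funext fun r => mulVec_line A b p v t r
  | hidden A b Φ ih =>
    obtain ⟨a₁, h1, h2, p₁, v₁, h3⟩ := exists_affine_layer A b p v a
      (L := 2 ^ Φ.size * L) (by positivity)
    obtain ⟨a₂, h4, h5, p₂, v₂, h6⟩ := ih p₁ v₁ a₁
    refine ⟨a₂, h1.trans h4, (h5.trans h2).trans_eq ?_, p₂, v₂, fun t ht => ?_⟩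
    · simp only [size, pow_add]; ring
    · rw [← h6 t ht, ← h3 t ⟨h4.trans ht.1, ht.2.trans h5⟩]
      rfl

/-- A network with at most `m` weights is not uniformly within `1 / 6` of a wave between `2 / 3`
and `1` of frequency `2 ^ (m + 1)`: on an interval of length `2 ^ (-m)` it would be affine, and yet
lie below, above and again below the level `5 / 6`. -/
lemma not_forall_abs_sub_wave_lt {d m : ℕ} (Φ : ReLUNet d 1) (hΦ : Φ.size ≤ m)
    (p v : Fin d → ℝ) :
    ¬ ∀ t ∈ Set.Icc (0 : ℝ) 1, |Φ.eval (p + t • v) 0 -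
      (2 / 3 + 1 / 3 * Real.sin (t * 2 ^ (m + 1) * Real.pi) ^ 2)| < 1 / 6 := by
  intro h
  have hpos : (0 : ℝ) < 2 ^ Φ.size := by positivity
  obtain ⟨a, ha0, ha1, p', v', hlin⟩ := exists_affine_eval Φ p v 0
    (L := 1 / 2 ^ Φ.size) (by positivity)
  rw [mul_one_div_cancel hpos.ne', zero_add] at ha1
  set M : ℝ := 2 ^ (m + 1) with hM
  have hM0 : 0 < M := by positivity
  have hML : 2 / M ≤ 1 / 2 ^ Φ.size := by
    have h1 : (2 : ℝ) / M = 1 / 2 ^ m := by rw [hM, pow_succ]; field_simp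
    rw [h1]
    exact one_div_le_one_div_of_le hpos (pow_le_pow_right₀ (by norm_num) hΦ)
  set n : ℤ := ⌈M * a⌉ with hn
  have hn1 : M * a ≤ n := Int.le_ceil _
  have hn2 : (n : ℝ) < M * a + 1 := Int.ceil_lt_add_one _
  have hmem : ∀ x : ℝ, 0 ≤ x → x ≤ 1 → (n + x) / M ∈ Set.Icc a (a + 1 / 2 ^ Φ.size) := by
    intro x hx0 hx1
    constructor
    · rw [le_div_iff₀ hM0]; linarith
    · refine le_trans ?_ (add_le_add_right hML a)
      rw [div_le_iff₀ hM0, add_mul, div_mul_cancel₀ _ hM0.ne']; linarith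
  have hval : ∀ x : ℝ, 0 ≤ x → x ≤ 1 →
      |(p' 0 + (n + x) / M * v' 0) - (2 / 3 + 1 / 3 * Real.sin ((n + x) * Real.pi) ^ 2)|
        < 1 / 6 := by
    intro x hx0 hx1
    have hx := hmem x hx0 hx1
    have := h _ ⟨ha0.trans hx.1, hx.2.trans ha1⟩
    rw [hlin _ hx, div_mul_cancel₀ _ hM0.ne'] at this
    simpa using this
  have e0 := hval 0 le_rfl zero_le_one
  have e1 := hval (1 / 2) (by norm_num) (by norm_num)
  have e2 := hval 1 zero_le_one le_rfl
  have s0 : Real.sin (((n : ℝ) + 0) * Real.pi) = 0 := by rw [add_zero]; exact Real.sin_int_mul_pi n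
  have s2 : Real.sin (((n : ℝ) + 1) * Real.pi) = 0 := by
    have := Real.sin_int_mul_pi (n + 1)
    push_cast at this
    exact this
  have s1 : Real.sin (((n : ℝ) + 1 / 2) * Real.pi) ^ 2 = 1 := by
    have : ((n : ℝ) + 1 / 2) * Real.pi = n * Real.pi + Real.pi / 2 := by ring
    rw [this, Real.sin_add_pi_div_two]
    have := Real.sin_sq_add_cos_sq (n * Real.pi)
    rw [Real.sin_int_mul_pi] at this
    linarith
  rw [s0, abs_lt] at e0
  rw [s1, abs_lt] at e1
  rw [s2, abs_lt] at e2
  have hmid : p' 0 + (n + 1 / 2) / M * v' 0 =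
      ((p' 0 + (n + 0) / M * v' 0) + (p' 0 + (n + 1) / M * v' 0)) / 2 := by ring
  linarith [e0.2, e1.1, e2.2]

lemma eval_eq_zero_of_size_eq_zero {d e : ℕ} (Φ : ReLUNet d e) (h : Φ.size = 0)
    (x : Fin d → ℝ) : Φ.eval x = 0 := by
  induction Φ with
  | output A b =>
    simp only [size, layerSize, Nat.add_eq_zero_iff, Set.ncard_eq_zero (Set.toFinite _)] at h
    have hA : A = 0 := by
      ext r j
      by_contra hne
      exact Set.eq_empty_iff_forall_notMem.mp h.1 (r, j) hne
    have hb : b = 0 := by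
      ext r
      by_contra hne
      exact Set.eq_empty_iff_forall_notMem.mp h.2 r hne
    ext r
    simp [eval, hA, hb]
  | hidden A b Φ ih => exact ih (Nat.add_eq_zero_iff.mp h).2 _

/-- The network without hidden layers that computes the constant `c`. -/
def const (d : ℕ) (c : ℝ) : ReLUNet d 1 := output 0 fun _ => c

lemma size_const_le (d : ℕ) (c : ℝ) : (const d c).size ≤ 1 := by
  have h : Set.ncard {i : Fin 1 | c ≠ 0} ≤ 1 := by
    refine (Set.ncard_le_ncard (Set.subset_univ _) (Set.toFinite _)).trans ?_
    simp
  simpa [const, size, layerSize] using h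

lemma size_const_zero (d : ℕ) : (const d 0).size = 0 := by
  simp [const, size, layerSize]

lemma eval_const (d : ℕ) (c : ℝ) (x : Fin d → ℝ) : (const d c).eval x = fun _ => c := by
  ext; simp [const, eval]

end ReLUNet

/-! ### Spikes with separated centres -/

lemma hat_self (δ a : ℝ) : hat δ a a = 1 := by simp [hat]

lemma hat_eq_zero {δ a x : ℝ} (hδ : 0 < δ) (h : δ ≤ |x - a|) : hat δ a x = 0 := by
  rw [hat, max_eq_right]
  rw [sub_nonpos, le_div_iff₀ hδ, one_mul]
  exact h

lemma hat_nonneg (δ a x : ℝ) : 0 ≤ hat δ a x := le_max_right _ _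

lemma hat_le_one {δ : ℝ} (hδ : 0 < δ) (a x : ℝ) : hat δ a x ≤ 1 := by
  refine max_le ?_ zero_le_one
  have : 0 ≤ |x - a| / δ := by positivity
  linarith

lemma continuous_hat (δ a : ℝ) : Continuous (hat δ a) := by
  unfold hat
  fun_prop

/-- The centres `c` are so far apart that hats of half-width `δ` around them do not overlap. -/
def SpikeSeparated {ι : Type*} (δ : ℝ) (c : ι → ℝ) : Prop :=
  ∀ o o', o ≠ o' → 2 * δ ≤ |c o - c o'|

lemma SpikeSeparated.eq_of_abs_lt {ι : Type*} {δ : ℝ} {c : ι → ℝ} (hc : SpikeSeparated δ c)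
    {x : ℝ} {o o' : ι} (h : |x - c o| < δ) (h' : |x - c o'| ≤ δ) : o = o' := by
  by_contra hne
  have h1 := hc o o' hne
  have h2 := abs_sub_le (c o) x (c o')
  rw [abs_sub_comm (c o) x] at h2
  linarith

lemma SpikeSeparated.sum_hat {ι : Type*} [Fintype ι] {δ : ℝ} (hδ : 0 < δ) {c : ι → ℝ}
    (hc : SpikeSeparated δ c) (w : ι → ℝ) {x : ℝ} {o : ι} (h : |x - c o| < δ) :
    ∑ o', w o' * hat δ (c o') x = w o * hat δ (c o) x := by
  refine Fintype.sum_eq_single o fun o' hne => ?_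
  rw [hat_eq_zero hδ, mul_zero]
  by_contra hlt
  exact hne (hc.eq_of_abs_lt h (not_le.mp hlt).le).symm

lemma SpikeSeparated.sum_hat_mem {ι : Type*} [Fintype ι] {δ : ℝ} (hδ : 0 < δ) {c : ι → ℝ}
    (hc : SpikeSeparated δ c) {w : ι → ℝ} (hw : ∀ o, w o ∈ Set.Icc (0 : ℝ) 1) (x : ℝ) :
    ∑ o, w o * hat δ (c o) x ∈ Set.Icc (0 : ℝ) 1 := by
  by_cases h : ∃ o, |x - c o| < δ
  · obtain ⟨o, ho⟩ := h
    rw [hc.sum_hat hδ w ho]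
    exact ⟨mul_nonneg (hw o).1 (hat_nonneg _ _ _),
      mul_le_one₀ (hw o).2 (hat_nonneg _ _ _) (hat_le_one hδ _ _)⟩
  · rw [Finset.sum_eq_zero]
    · simp
    · intro o _
      rw [hat_eq_zero hδ, mul_zero]
      by_contra hlt
      exact h ⟨o, not_le.mp hlt⟩

/-! ### The tasks -/

/-- The spike centres of a task with address `y`: `none` is the address, `some j` the static point
number `j`. -/
noncomputable def spikeCenter (N : ℕ) (y : ℝ) : Option (Fin (N - 1)) → ℝ
  | none => y
  | some j => staticPoint N j

section Tasks

variable {N : ℕ} {δ : ℝ} {g : (Fin (N - 1) → ℝ) → ℝ}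

lemma staticPoint_mem (hN : 3 ≤ N) (j : Fin (N - 1)) :
    staticPoint N j ∈ Set.Icc (0 : ℝ) (1 / 2) := by
  have h1 : (3 : ℝ) ≤ N := by exact_mod_cast hN
  have h2 : (j : ℝ) ≤ N - 1 := by
    rw [le_sub_iff_add_le]
    exact_mod_cast (by omega : (j : ℕ) + 1 ≤ N)
  have h3 : (0 : ℝ) < 2 * (N - 1) := by linarith
  refine ⟨div_nonneg (Nat.cast_nonneg _) h3.le, ?_⟩
  rw [staticPoint, div_le_iff₀ h3]
  linarith

lemma staticPoint_mem_unit (hN : 3 ≤ N) (j : Fin (N - 1)) : staticPoint N j ∈ I :=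
  Set.Icc_subset_Icc_right (by norm_num) (staticPoint_mem hN j)

lemma lt_one_div_eighteen (hN : 3 ≤ N) (hδ : δ < 1 / (6 * (N : ℝ))) : δ < 1 / 18 := by
  refine hδ.trans_le (one_div_le_one_div_of_le (by norm_num) ?_)
  have h1 : (3 : ℝ) ≤ N := by exact_mod_cast hN
  linarith

lemma spikeSeparated (hN : 3 ≤ N) (hδ : δ < 1 / (6 * (N : ℝ))) {y : ℝ} (hy : 2 / 3 ≤ y) :
    SpikeSeparated δ (spikeCenter N y) := by
  have h18 := lt_one_div_eighteen hN hδ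
  have h1 : (3 : ℝ) ≤ N := by exact_mod_cast hN
  intro o o' hne
  rcases o with _ | j <;> rcases o' with _ | j'
  · exact absurd rfl hne
  · rw [le_abs]
    have := (staticPoint_mem hN j').2
    exact Or.inl (by simp only [spikeCenter]; linarith)
  · rw [le_abs]
    have := (staticPoint_mem hN j).2
    exact Or.inr (by simp only [spikeCenter]; linarith)
  · have h3 : (0 : ℝ) < 2 * (N - 1) := by linarith
    have hjj : (j : ℤ) - j' ≠ 0 := by
      rw [sub_ne_zero]
      intro h
      exact hne (congrArg some (Fin.ext (by exact_mod_cast h)))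
    have h4 : (1 : ℝ) ≤ |(j : ℝ) - j'| := by exact_mod_cast Int.one_le_abs hjj
    simp only [spikeCenter, staticPoint]
    rw [← sub_div, abs_div, abs_of_pos h3, le_div_iff₀ h3]
    rw [lt_div_iff₀ (by linarith)] at hδ
    nlinarith

lemma tent_mem {n : ℕ} {s : Fin n → ℝ} (hs : s ∈ Set.Icc 0 1) : tent s ∈ Set.Icc 0 1 := by
  refine ⟨fun i => ?_, fun i => ?_⟩
  · have h0 : 0 ≤ s i := hs.1 i
    have h1 : s i ≤ 1 := hs.2 i
    have : 0 ≤ min (s i) (1 - s i) := le_min h0 (by linarith)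
    simp only [tent, Pi.zero_apply]; linarith
  · simp only [tent, Pi.one_apply]
    linarith [min_le_left (s i) (1 - s i), min_le_right (s i) (1 - s i)]

lemma tent_half {n : ℕ} {u : Fin n → ℝ} (hu : u ∈ Set.Icc 0 1) :
    tent (fun i => u i / 2) = u := by
  ext i
  have h1 : u i ≤ 1 := hu.2 i
  rw [tent, min_eq_left (by linarith)]
  ring

lemma half_mem {n : ℕ} {u : Fin n → ℝ} (hu : u ∈ Set.Icc 0 1) :
    (fun i => u i / 2) ∈ Set.Icc (0 : Fin n → ℝ) 1 := by
  refine ⟨fun i => ?_, fun i => ?_⟩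
  · have h0 : 0 ≤ u i := hu.1 i
    simp only [Pi.zero_apply]; linarith
  · have h1 : u i ≤ 1 := hu.2 i
    simp only [Pi.one_apply]; linarith

lemma continuous_tent {n : ℕ} : Continuous (tent : (Fin n → ℝ) → Fin n → ℝ) := by
  unfold tent
  fun_prop

lemma addrTask_eq_sum (s : Fin (N - 1) → ℝ) (β : ℝ) (x : I) :
    addrTask N δ g s β x = ∑ o : Option (Fin (N - 1)),
      (o.elim β s) * hat δ (spikeCenter N (g (tent s)) o) x := by
  rw [Fintype.sum_option, add_comm]
  rfl

lemma addrTask_zero_apply (s : Fin (N - 1) → ℝ) (x : I) :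
    addrTask N δ g s 0 x = ∑ i, s i * hat δ (staticPoint N i) x := by
  simp [addrTask]

/-- Near a spike centre, a task equals that spike. -/
lemma addrTask_of_abs_lt (hN : 3 ≤ N) (hδ₀ : 0 < δ) (hδ : δ < 1 / (6 * (N : ℝ)))
    {s : Fin (N - 1) → ℝ} (hg : 2 / 3 ≤ g (tent s)) (β : ℝ) {x : I} {o : Option (Fin (N - 1))}
    (h : |(x : ℝ) - spikeCenter N (g (tent s)) o| < δ) :
    addrTask N δ g s β x = o.elim β s * hat δ (spikeCenter N (g (tent s)) o) x := by
  rw [addrTask_eq_sum]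
  exact (spikeSeparated hN hδ hg).sum_hat hδ₀ (fun o => o.elim β s) h

lemma addrTask_center (hN : 3 ≤ N) (hδ₀ : 0 < δ) (hδ : δ < 1 / (6 * (N : ℝ)))
    {s : Fin (N - 1) → ℝ} (hg : 2 / 3 ≤ g (tent s)) (β : ℝ) {x : I} {o : Option (Fin (N - 1))}
    (h : (x : ℝ) = spikeCenter N (g (tent s)) o) :
    addrTask N δ g s β x = o.elim β s := by
  rw [addrTask_of_abs_lt hN hδ₀ hδ hg β (o := o) (by simpa [h] using hδ₀), h, hat_self, mul_one]

lemma addrTask_mem_Icc (hN : 3 ≤ N) (hδ₀ : 0 < δ) (hδ : δ < 1 / (6 * (N : ℝ)))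
    {s : Fin (N - 1) → ℝ} (hs : s ∈ Set.Icc 0 1) (hg : 2 / 3 ≤ g (tent s)) {β : ℝ}
    (hβ : β ∈ ({0, 1} : Set ℝ)) (x : I) :
    addrTask N δ g s β x ∈ Set.Icc (0 : ℝ) 1 := by
  rw [addrTask_eq_sum]
  refine (spikeSeparated hN hδ hg).sum_hat_mem hδ₀ (w := fun o => o.elim β s) (fun o => ?_) x
  rcases o with _ | j
  · rcases hβ with rfl | rfl <;> simp
  · exact ⟨hs.1 j, hs.2 j⟩

/-- Tasks that differ only in the hidden bit agree off the moving spike. -/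
lemma addrTask_eq_of_le_abs (hδ₀ : 0 < δ) (s : Fin (N - 1) → ℝ) (β β' : ℝ) {x : I}
    (h : δ ≤ |(x : ℝ) - g (tent s)|) : addrTask N δ g s β x = addrTask N δ g s β' x := by
  simp only [addrTask, hat_eq_zero hδ₀ h, mul_zero]

/-- Spike-free tasks that differ only in the coefficient number `j` agree off the spike number
`j`. -/
lemma addrTask_update_of_le_abs (hδ₀ : 0 < δ) (s : Fin (N - 1) → ℝ) (j : Fin (N - 1)) (a : ℝ)
    {x : I} (h : δ ≤ |(x : ℝ) - staticPoint N j|) :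
    addrTask N δ g (Function.update s j a) 0 x = addrTask N δ g s 0 x := by
  rw [addrTask_zero_apply, addrTask_zero_apply]
  refine Finset.sum_congr rfl fun i _ => ?_
  by_cases hij : i = j
  · subst hij
    rw [hat_eq_zero hδ₀ h, mul_zero, mul_zero]
  · rw [Function.update_of_ne hij]

lemma addrTask_mem_addrFamily {s : Fin (N - 1) → ℝ} (hs : s ∈ Set.Icc 0 1) {β : ℝ}
    (hβ : β ∈ ({0, 1} : Set ℝ)) : addrTask N δ g s β ∈ addrFamily N δ g :=
  ⟨s, hs, β, hβ, rfl⟩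

end Tasks

/-! ### Worst-case errors -/

lemma enorm_sub_le_worstError {X : Type*} {T : Set (X → ℝ)} (P : (X → ℝ) → X → ℝ) {f : X → ℝ}
    (hf : f ∈ T) (x : X) : ‖P f x - f x‖ₑ ≤ worstError T P :=
  (le_iSup (fun x => ‖P f x - f x‖ₑ) x).trans
    (le_iSup₂ (f := fun (f : X → ℝ) (_ : f ∈ T) => ⨆ x : X, ‖P f x - f x‖ₑ) f hf)

/-- A learner that cannot tell apart two tasks at uniform distance at least `1` errs by at least
`1 / 2` on one of them. -/
lemma half_le_worstError {X : Type*} {T : Set (X → ℝ)} {P : (X → ℝ) → X → ℝ} {f f' : X → ℝ}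
    (hf : f ∈ T) (hf' : f' ∈ T) (hP : P f = P f') {x : X} (hx : f x = 0) (hx' : f' x = 1) :
    1 / 2 ≤ worstError T P := by
  by_contra! hlt
  have h1 := (enorm_sub_le_worstError P hf x).trans_lt hlt
  have h2 := (enorm_sub_le_worstError P hf' x).trans_lt hlt
  rw [hP, hx, sub_zero] at h1
  rw [hx'] at h2
  have h3 : (1 : ℝ≥0∞) ≤ ‖P f' x‖ₑ + ‖P f' x - 1‖ₑ := by
    calc (1 : ℝ≥0∞) = ‖P f' x - (P f' x - 1)‖ₑ := by simp
      _ ≤ _ := enorm_sub_le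
  have h4 : (1 / 2 : ℝ≥0∞) + 1 / 2 = 1 := ENNReal.add_halves 1
  exact absurd (h3.trans_lt (ENNReal.add_lt_add h1 h2)) (by rw [h4]; exact lt_irrefl _)

lemma worstError_const_half_le {X : Type*} {T : Set (X → ℝ)}
    (hT : ∀ f ∈ T, ∀ x, f x ∈ Set.Icc (0 : ℝ) 1) :
    worstError T (fun _ _ => 1 / 2) ≤ 1 / 2 := by
  refine iSup₂_le fun f hf => iSup_le fun x => ?_
  have h := hT f hf x
  have h1 : |1 / 2 - f x| ≤ 1 / 2 := abs_le.mpr ⟨by linarith [h.2], by linarith [h.1]⟩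
  rw [Real.enorm_eq_ofReal_abs]
  refine (ENNReal.ofReal_le_ofReal h1).trans_eq ?_
  rw [ENNReal.ofReal_div_of_pos two_pos]
  simp

/-! ### Runs of agentic learners -/

namespace Agent

variable {X : Type*} {N : ℕ}

/-- The query point number `i + 1` of the run of `Ψ` on the task `f`. -/
def queryPoint (Ψ : Agent X N) (f : X → ℝ) (i : ℕ) : X := Ψ.next i (Ψ.context f i)

lemma context_succ (Ψ : Agent X N) (f : X → ℝ) (n : ℕ) :
    Ψ.context f (n + 1) = Fin.snoc (α := fun _ => X × ℝ) (Ψ.context f n)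
      (Ψ.queryPoint f n, f (Ψ.queryPoint f n)) := rfl

lemma context_apply (Ψ : Agent X N) (f : X → ℝ) {n : ℕ} (i : Fin n) :
    Ψ.context f n i = (Ψ.queryPoint f i, f (Ψ.queryPoint f i)) := by
  induction n with
  | zero => exact i.elim0
  | succ n ih =>
    rw [context_succ]
    refine Fin.lastCases ?_ (fun i => ?_) i
    · rw [Fin.snoc_last]; rfl
    · rw [Fin.snoc_castSucc, ih i]; rfl

/-- Two tasks that agree on the query points of the run on the first have the same run. -/
lemma context_congr (Ψ : Agent X N) {f f' : X → ℝ} {n : ℕ}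
    (h : ∀ i < n, f (Ψ.queryPoint f i) = f' (Ψ.queryPoint f i)) :
    Ψ.context f n = Ψ.context f' n := by
  induction n with
  | zero => rfl
  | succ n ih =>
    have hc := ih fun i hi => h i (hi.trans n.lt_succ_self)
    have hq : Ψ.queryPoint f' n = Ψ.queryPoint f n := by rw [queryPoint, ← hc]; rfl
    rw [context_succ, context_succ, hq, hc, h n n.lt_succ_self]

lemma output_congr (Ψ : Agent X N) {f f' : X → ℝ}
    (h : ∀ i < N, f (Ψ.queryPoint f i) = f' (Ψ.queryPoint f i)) :
    Ψ.output f = Ψ.output f' := by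
  rw [output, output, Ψ.context_congr h]

end Agent

lemma continuous_vec {n : ℕ} : Continuous (Context.vec : Context I n → Fin (n + n) → ℝ) := by
  refine continuous_pi fun e => ?_
  refine Fin.addCases (fun i => ?_) (fun i => ?_) e
  · simp only [Context.vec, Fin.append_left]
    fun_prop
  · simp only [Context.vec, Fin.append_right]
    fun_prop

lemma Agent.QueriesRealizable.continuous_query {N m : ℕ} {Ψ : Agent I N}
    (h : Ψ.QueriesRealizable m) {k : ℕ} (hk : k + 2 ≤ N) : Continuous (Ψ.query k) := by
  obtain ⟨Φ, -, hΦ⟩ := h k hk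
  refine continuous_induced_rng.mpr ?_
  have : Subtype.val ∘ Ψ.query k = fun c => Φ.eval c.vec 0 := funext hΦ
  rw [this]
  exact (continuous_apply 0).comp (Φ.continuous_eval.comp continuous_vec)

section Runs

variable {N m : ℕ} {δ : ℝ} {g : (Fin (N - 1) → ℝ) → ℝ} {Ψ : Agent I N}

/-- The query points on a spike-free task depend continuously on its coefficients. -/
lemma continuous_queryPoint (hΨ : Ψ.QueriesRealizable m) {i : ℕ} (hi : i < N) :
    Continuous fun s => Ψ.queryPoint (addrTask N δ g s 0) i := by
  have hnext : ∀ n < N, Continuous (fun s => Ψ.context (addrTask N δ g s 0) n) →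
      Continuous fun s => Ψ.queryPoint (addrTask N δ g s 0) n := by
    intro n hn hc
    cases n with
    | zero => exact continuous_const
    | succ k => exact (hΨ.continuous_query hn).comp hc
  refine hnext i hi ?_
  induction i with
  | zero => exact continuous_const
  | succ n ih =>
    have hc := ih (by omega)
    have hq := hnext n (by omega) hc
    simp only [Agent.context_succ]
    refine Continuous.finSnoc hc (hq.prodMk ?_)
    simp only [addrTask_zero_apply]
    refine continuous_finsetSum _ fun j _ => (continuous_apply j).mul ?_
    exact (continuous_hat _ _).comp (continuous_subtype_val.comp hq)

/-- A learner with error below `1 / 2` must, on every spike-free task, query near each of the `N`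
spike centres: otherwise it could not notice a change of that coefficient. -/
lemma exists_queryPoint_near (hN : 3 ≤ N) (hδ₀ : 0 < δ) (hδ : δ < 1 / (6 * (N : ℝ)))
    (hg : ∀ u ∈ Set.Icc 0 1, g u ∈ Set.Icc (2 / 3 : ℝ) 1)
    (herr : worstError (addrFamily N δ g) Ψ.output < 1 / 2)
    {s : Fin (N - 1) → ℝ} (hs : s ∈ Set.Icc 0 1) (o : Option (Fin (N - 1))) :
    ∃ i : Fin N, |(Ψ.queryPoint (addrTask N δ g s 0) i : ℝ) -
      spikeCenter N (g (tent s)) o| < δ := by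
  by_contra! hfar
  refine herr.not_ge ?_
  have hgs := hg _ (tent_mem hs)
  rcases o with _ | j
  · have hx : g (tent s) ∈ I := ⟨by linarith [hgs.1], hgs.2⟩
    refine half_le_worstError (x := ⟨g (tent s), hx⟩)
      (addrTask_mem_addrFamily hs (β := 0) (by simp))
      (addrTask_mem_addrFamily hs (β := 1) (by simp)) (Ψ.output_congr fun i hi => ?_)
      (addrTask_center hN hδ₀ hδ hgs.1 _ (o := none) rfl)
      (addrTask_center hN hδ₀ hδ hgs.1 _ (o := none) rfl)
    exact addrTask_eq_of_le_abs hδ₀ s 0 1 (hfar ⟨i, hi⟩)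
  · have hmem : ∀ a ∈ Set.Icc (0 : ℝ) 1, Function.update s j a ∈ Set.Icc 0 1 := by
      intro a ha
      refine ⟨?_, ?_⟩
      · rw [le_update_iff]; exact ⟨ha.1, fun i _ => hs.1 i⟩
      · rw [update_le_iff]; exact ⟨ha.2, fun i _ => hs.2 i⟩
    have hout : ∀ a, Ψ.output (addrTask N δ g s 0) =
        Ψ.output (addrTask N δ g (Function.update s j a) 0) := fun a =>
      Ψ.output_congr fun i hi => (addrTask_update_of_le_abs hδ₀ s j a (hfar ⟨i, hi⟩)).symm
    have hval : ∀ a ∈ Set.Icc (0 : ℝ) 1, addrTask N δ g (Function.update s j a) 0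
        ⟨staticPoint N j, staticPoint_mem_unit hN j⟩ = a := by
      intro a ha
      rw [addrTask_center hN hδ₀ hδ (hg _ (tent_mem (hmem a ha))).1 _ (o := some j) rfl]
      simp
    have h0 : (0 : ℝ) ∈ Set.Icc (0 : ℝ) 1 := by simp
    have h1 : (1 : ℝ) ∈ Set.Icc (0 : ℝ) 1 := by simp
    exact half_le_worstError
      (addrTask_mem_addrFamily (hmem 0 h0) (by simp))
      (addrTask_mem_addrFamily (hmem 1 h1) (by simp))
      ((hout 0).symm.trans (hout 1)) (hval 0 h0) (hval 1 h1)

/-- A learner with realizable query maps and error below `1 / 2` visits the spike centres in an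
order that does not depend on the spike-free task: there are as many queries as centres, so each
query serves exactly one centre, and the cube of coefficients is connected. -/
lemma exists_schedule (hN : 3 ≤ N) (hδ₀ : 0 < δ) (hδ : δ < 1 / (6 * (N : ℝ)))
    (hgc : ContinuousOn g (Set.Icc 0 1))
    (hg : ∀ u ∈ Set.Icc 0 1, g u ∈ Set.Icc (2 / 3 : ℝ) 1)
    (hΨ : Ψ.QueriesRealizable m)
    (herr : worstError (addrFamily N δ g) Ψ.output < 1 / 2) :
    ∃ τ : Option (Fin (N - 1)) ≃ Fin N, ∀ s ∈ Set.Icc (0 : Fin (N - 1) → ℝ) 1, ∀ o,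
      |(Ψ.queryPoint (addrTask N δ g s 0) (τ o) : ℝ) - spikeCenter N (g (tent s)) o| < δ := by
  have hnear := fun (s : Fin (N - 1) → ℝ) (hs : s ∈ Set.Icc 0 1) =>
    exists_queryPoint_near (Ψ := Ψ) hN hδ₀ hδ hg herr hs
  have hsep := fun (s : Fin (N - 1) → ℝ) (hs : s ∈ Set.Icc 0 1) =>
    spikeSeparated hN hδ (hg _ (tent_mem hs)).1
  have hbij : ∀ s ∈ Set.Icc (0 : Fin (N - 1) → ℝ) 1, ∃ τ : Option (Fin (N - 1)) ≃ Fin N, ∀ o,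
      |(Ψ.queryPoint (addrTask N δ g s 0) (τ o) : ℝ) - spikeCenter N (g (tent s)) o| < δ := by
    intro s hs
    choose τ hτ using hnear s hs
    have hinj : Function.Injective τ := by
      intro o o' hoo
      exact (hsep s hs).eq_of_abs_lt (hτ o) (by rw [hoo]; exact (hτ o').le)
    have hb : Function.Bijective τ := by
      rw [Fintype.bijective_iff_injective_and_card]
      refine ⟨hinj, ?_⟩
      simp only [Fintype.card_option, Fintype.card_fin]
      omega
    exact ⟨Equiv.ofBijective τ hb, hτ⟩
  have h0 : (0 : Fin (N - 1) → ℝ) ∈ Set.Icc 0 1 := Set.left_mem_Icc.mpr zero_le_one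
  obtain ⟨τ, hτ⟩ := hbij 0 h0
  refine ⟨τ, fun s hs o => ?_⟩
  by_contra! hge
  -- the distance to the centre cannot pass through `δ`, since a query near another centre would
  -- be farther away
  have hcont : ContinuousOn (fun s => |(Ψ.queryPoint (addrTask N δ g s 0) (τ o) : ℝ) -
      spikeCenter N (g (tent s)) o|) (Set.Icc 0 1) := by
    refine ContinuousOn.abs (ContinuousOn.sub ?_ ?_)
    · exact (continuous_subtype_val.comp
        (continuous_queryPoint hΨ (τ o).isLt)).continuousOn
    · rcases o with _ | j
      · exact hgc.comp continuous_tent.continuousOn fun s hs => tent_mem hs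
      · exact continuousOn_const
  obtain ⟨s', hs', hs'δ⟩ := (convex_Icc (0 : Fin (N - 1) → ℝ) 1).isPreconnected.intermediate_value
    h0 hs hcont ⟨(hτ o).le, hge⟩
  obtain ⟨τ', hτ'⟩ := hbij s' hs'
  have h1 := hτ' (τ'.symm (τ o))
  rw [Equiv.apply_symm_apply] at h1
  have h2 := (hsep s' hs').eq_of_abs_lt h1 hs'δ.le
  rw [h2] at h1
  exact h1.ne hs'δ

/-- A query that hits the address on all spike-free tasks is not a fixed point. -/
lemma not_forall_queryPoint_eq (hδ : δ < 1 / 6)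
    (hsurj : g '' Set.Icc 0 1 = Set.Icc (2 / 3) 1) {i : ℕ}
    (h : ∀ s ∈ Set.Icc (0 : Fin (N - 1) → ℝ) 1,
      |(Ψ.queryPoint (addrTask N δ g s 0) i : ℝ) - g (tent s)| < δ) (x : I) :
    ¬ ∀ s, Ψ.queryPoint (addrTask N δ g s 0) i = x := by
  intro hx
  have key : ∀ y ∈ Set.Icc (2 / 3 : ℝ) 1, |(x : ℝ) - y| < δ := by
    intro y hy
    rw [← hsurj] at hy
    obtain ⟨u, hu, rfl⟩ := hy
    have := h _ (half_mem hu)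
    rwa [hx, tent_half hu] at this
  have h1 := abs_lt.mp (key (2 / 3) ⟨le_rfl, by norm_num⟩)
  have h2 := abs_lt.mp (key 1 ⟨by norm_num, le_rfl⟩)
  linarith [h1.2, h2.1]

end Runs

/-! ### Upper bounds: the exact learner and the constant learners -/

section Learners

variable {N m : ℕ} {δ : ℝ}

/-- The learner that reads all static coefficients, computes the address, and reads the hidden bit
there. The address is projected to `[0,1]`, which matters only for contexts that no task of the
family produces. -/
noncomputable def exactAgent (k : ℕ) (hN : 3 ≤ k + 2) (δ : ℝ) (g : (Fin (k + 1) → ℝ) → ℝ) :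
    Agent I (k + 2) where
  first := ⟨staticPoint (k + 2) (0 : Fin (k + 1)), staticPoint_mem_unit hN _⟩
  query := fun n c =>
    if h : n + 1 < k + 1 then ⟨staticPoint (k + 2) ⟨n + 1, h⟩, staticPoint_mem_unit hN _⟩
    else Set.projIcc 0 1 zero_le_one (g (tent fun i => if h : (i : ℕ) < n + 1 then (c ⟨i, h⟩).2
      else 0))
  predictor := fun c => addrTask (k + 2) δ g (fun i => (c i.castSucc).2) (c (Fin.last _)).2

lemma exactAgent_fixedButLast (k : ℕ) (hN : 3 ≤ k + 2) (g : (Fin (k + 1) → ℝ) → ℝ) :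
    (exactAgent k hN δ g).FixedButLast := by
  intro n hn c c'
  have h : n + 1 < k + 1 := by omega
  simp only [exactAgent, dif_pos h]

lemma exactAgent_output {k : ℕ} (hN : 3 ≤ k + 2) (hδ₀ : 0 < δ)
    (hδ : δ < 1 / (6 * ((k + 2 : ℕ) : ℝ))) {g : (Fin (k + 1) → ℝ) → ℝ}
    (hg : ∀ u ∈ Set.Icc 0 1, g u ∈ Set.Icc (2 / 3 : ℝ) 1) {f : I → ℝ}
    (hf : f ∈ addrFamily (k + 2) δ g) : (exactAgent k hN δ g).output f = f := by
  obtain ⟨s, hs, β, hβ, rfl⟩ := hf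
  set f := addrTask (k + 2) δ g s β with hf
  have hgs := hg _ (tent_mem hs)
  have hx : g (tent s) ∈ I := ⟨by linarith [hgs.1], hgs.2⟩
  have hstatic : ∀ j : Fin (k + 1), f ⟨staticPoint (k + 2) j, staticPoint_mem_unit hN j⟩ = s j :=
    fun j => addrTask_center (N := k + 2) hN hδ₀ hδ hgs.1 β (o := some j) rfl
  have hq : ∀ j : Fin (k + 1), (exactAgent k hN δ g).queryPoint f j =
      ⟨staticPoint (k + 2) j, staticPoint_mem_unit hN j⟩ := by
    rintro ⟨j, hj⟩
    cases j with
    | zero => rfl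
    | succ n =>
      simp only [Agent.queryPoint, Agent.next, exactAgent, dif_pos hj]
  have hlast : (exactAgent k hN δ g).queryPoint f (k + 1) = ⟨g (tent s), hx⟩ := by
    have harg : (fun i : Fin (k + 1) => if h : (i : ℕ) < k + 1 then
        ((exactAgent k hN δ g).context f (k + 1) ⟨i, h⟩).2 else 0) = s := by
      ext i
      rw [dif_pos i.isLt, Agent.context_apply]
      simp only [hq]
      exact hstatic i
    have : (exactAgent k hN δ g).queryPoint f (k + 1) =
        Set.projIcc 0 1 zero_le_one (g (tent fun i : Fin (k + 1) => if h : (i : ℕ) < k + 1 then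
          ((exactAgent k hN δ g).context f (k + 1) ⟨i, h⟩).2 else 0)) := by
      simp only [Agent.queryPoint, Agent.next]
      exact dif_neg (lt_irrefl _)
    rw [this, harg, Set.projIcc_of_mem _ hx]
  have h1 : (fun i : Fin (k + 1) =>
      ((exactAgent k hN δ g).context f (k + 2) i.castSucc).2) = s := by
    ext i
    rw [Agent.context_apply]
    simp only [Fin.val_castSucc, hq]
    exact hstatic i
  have h2 : ((exactAgent k hN δ g).context f (k + 2) (Fin.last _)).2 = β := by
    rw [Agent.context_apply]
    simp only [Fin.val_last, hlast]
    exact addrTask_center (N := k + 2) hN hδ₀ hδ hgs.1 β (o := none) rfl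
  change addrTask (k + 2) δ g (fun i : Fin (k + 1) =>
      ((exactAgent k hN δ g).context f (k + 2) i.castSucc).2)
    ((exactAgent k hN δ g).context f (k + 2) (Fin.last _)).2 = f
  rw [h1, h2]

lemma const_mem_ICR {c : ℝ} (hc : (ReLUNet.const (N + N + 1) c).size ≤ m) :
    (fun _ _ => c) ∈ ICR N m :=
  ⟨⟨fun _ => 0, fun _ _ => c⟩, ⟨ReLUNet.const _ c, hc, fun _ _ => by rw [ReLUNet.eval_const]⟩, rfl⟩

lemma const_mem_AR {c : ℝ} (hc : (ReLUNet.const (N + N + 1) c).size ≤ m) :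
    (fun _ _ => c) ∈ AR N m :=
  ⟨⟨0, fun _ _ => 0, fun _ _ => c⟩,
    fun _ _ => ⟨ReLUNet.const _ 0, by rw [ReLUNet.size_const_zero]; exact Nat.zero_le _,
      fun _ => by rw [ReLUNet.eval_const]; rfl⟩,
    ⟨ReLUNet.const _ c, hc, fun _ _ => by rw [ReLUNet.eval_const]⟩, rfl⟩

lemma PredictorRealizable.eq_zero {F : Context I N → I → ℝ} (h : PredictorRealizable 0 F) :
    F = fun _ _ => 0 := by
  obtain ⟨Φ, hs, hΦ⟩ := h
  funext c x
  rw [hΦ, Φ.eval_eq_zero_of_size_eq_zero (Nat.le_zero.mp hs)]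
  rfl

end Learners

/-! ### Lower bounds -/

section LowerBounds

variable {N m : ℕ} {δ : ℝ} {g : (Fin (N - 1) → ℝ) → ℝ}

/-- By the pigeonhole principle, `N` intervals of radius `δ < 1 / (6 N)` miss one of the `N + 1`
points `2 / 3 + l / (3 N)`. -/
lemma exists_far_address (hN : 0 < N) (hδ : δ < 1 / (6 * (N : ℝ))) (x : Fin N → ℝ) :
    ∃ y ∈ Set.Icc (2 / 3 : ℝ) 1, ∀ i, δ ≤ |x i - y| := by
  have hN' : (0 : ℝ) < N := by exact_mod_cast hN
  by_contra! h
  have hmem : ∀ l : Fin (N + 1), 2 / 3 + (l : ℝ) / (3 * N) ∈ Set.Icc (2 / 3 : ℝ) 1 := by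
    intro l
    have hl : (l : ℝ) ≤ N := by exact_mod_cast Nat.lt_succ_iff.mp l.isLt
    have : (l : ℝ) / (3 * N) ≤ 1 / 3 := by
      rw [div_le_iff₀ (by positivity)]; linarith
    have h0 : 0 ≤ (l : ℝ) / (3 * N) := by positivity
    exact ⟨by linarith, by linarith⟩
  choose i hi using fun l => h _ (hmem l)
  obtain ⟨l, l', hne, hll⟩ := Fintype.exists_ne_map_eq_of_card_lt i (by simp)
  have h1 := hi l
  have h2 := hi l'
  rw [← hll] at h2
  have h3 := abs_sub_le (2 / 3 + (l : ℝ) / (3 * N)) (x (i l)) (2 / 3 + (l' : ℝ) / (3 * N))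
  rw [abs_sub_comm _ (x (i l))] at h3
  have hjj : (l : ℤ) - l' ≠ 0 := by
    rw [sub_ne_zero]
    intro h
    exact hne (Fin.ext (by exact_mod_cast h))
  have h4 : (1 : ℝ) ≤ |(l : ℝ) - l'| := by exact_mod_cast Int.one_le_abs hjj
  have h5 : 1 / (3 * (N : ℝ)) ≤
      |2 / 3 + (l : ℝ) / (3 * N) - (2 / 3 + (l' : ℝ) / (3 * N))| := by
    rw [add_sub_add_left_eq_sub, ← sub_div, abs_div, abs_of_pos (by positivity : 0 < 3 * (N : ℝ))]
    gcongr
  have h6 : 1 / (3 * (N : ℝ)) = 2 * (1 / (6 * N)) := by field_simp; norm_num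
  linarith

lemma half_le_worstError_ICLearner (hN : 3 ≤ N) (hδ₀ : 0 < δ) (hδ : δ < 1 / (6 * (N : ℝ)))
    (hsurj : g '' Set.Icc 0 1 = Set.Icc (2 / 3) 1) (Ψ : ICLearner I N) :
    1 / 2 ≤ worstError (addrFamily N δ g) Ψ.output := by
  obtain ⟨y, hy, hfar⟩ := exists_far_address (by omega) hδ fun i => (Ψ.point i : ℝ)
  have hy' := hy
  rw [← hsurj] at hy'
  obtain ⟨u, hu, rfl⟩ := hy'
  have hx : g u ∈ I := ⟨by linarith [hy.1], hy.2⟩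
  have ht := tent_half hu
  have hg : 2 / 3 ≤ g (tent fun i => u i / 2) := by rw [ht]; exact hy.1
  refine half_le_worstError (x := ⟨g u, hx⟩)
    (addrTask_mem_addrFamily (half_mem hu) (β := 0) (by simp))
    (addrTask_mem_addrFamily (half_mem hu) (β := 1) (by simp)) ?_
    (addrTask_center hN hδ₀ hδ hg _ (o := none) (by simp only [spikeCenter, ht]))
    (addrTask_center hN hδ₀ hδ hg _ (o := none) (by simp only [spikeCenter, ht]))
  unfold ICLearner.output
  congr 1
  funext i
  rw [addrTask_eq_of_le_abs hδ₀ _ 0 1 (by rw [ht]; exact hfar i)]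

lemma Agent.FixedButLast.queryPoint_eq {X : Type*} {Ψ : Agent X N} (h : Ψ.FixedButLast) {i : ℕ}
    (hi : i + 1 < N) (f f' : X → ℝ) : Ψ.queryPoint f i = Ψ.queryPoint f' i := by
  cases i with
  | zero => rfl
  | succ k => exact h k hi _ _

lemma enorm_lt_one_sixth_iff (a : ℝ) : ‖a‖ₑ < 1 / 6 ↔ |a| < 1 / 6 := by
  have h : (1 / 6 : ℝ≥0∞) = ENNReal.ofReal (1 / 6) := by
    rw [ENNReal.ofReal_div_of_pos (by norm_num)]; simp
  rw [Real.enorm_eq_ofReal_abs, h, ENNReal.ofReal_lt_ofReal_iff (by norm_num)]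

/-- If only the last query is adaptive, then it has to be the one that finds the address; read as a
function of `u = tent s` with `s = u / 2`, its network is too close to the address map. -/
lemma half_le_worstError_of_fixedButLast (hN : 3 ≤ N) (hδ₀ : 0 < δ)
    (hδ : δ < 1 / (6 * (N : ℝ))) (hg : IsHardAddressMap (N - 1) m g) {Ψ : Agent I N}
    (hfix : Ψ.FixedButLast) (hΨ : Ψ.QueriesRealizable m) :
    1 / 2 ≤ worstError (addrFamily N δ g) Ψ.output := by
  by_contra! herr
  obtain ⟨k, rfl⟩ : ∃ k, N = k + 2 := ⟨N - 2, by omega⟩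
  change (Fin (k + 1) → ℝ) → ℝ at g
  have h18 := lt_one_div_eighteen hN hδ
  have hmaps : ∀ u ∈ Set.Icc (0 : Fin (k + 1) → ℝ) 1, g u ∈ Set.Icc (2 / 3 : ℝ) 1 :=
    fun u hu => hg.image_eq ▸ Set.mem_image_of_mem g hu
  obtain ⟨τ, hτ⟩ := exists_schedule hN hδ₀ hδ hg.continuousOn hmaps hΨ herr
  have hlast : τ none = Fin.last (k + 1) := by
    by_contra hne
    have hlt : (τ none : ℕ) + 1 < k + 2 := Nat.succ_lt_succ (Fin.val_lt_last hne)
    exact not_forall_queryPoint_eq (Ψ := Ψ) (δ := δ) (by linarith) hg.image_eq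
      (fun s hs => hτ s hs none) _ (fun s => hfix.queryPoint_eq hlt _ (addrTask (k + 2) δ g 0 0))
  have hidx : ∀ i : Fin (k + 1), ∃ j : Fin (k + 1), τ (some j) = i.castSucc := by
    intro i
    rcases h : τ.symm i.castSucc with _ | j
    · rw [Equiv.symm_apply_eq, hlast] at h
      exact absurd h (Fin.castSucc_lt_last i).ne
    · rw [Equiv.symm_apply_eq] at h
      exact ⟨j, h.symm⟩
  choose idx hidx using hidx
  set x : Fin (k + 1) → I := fun i => Ψ.queryPoint (addrTask (k + 2) δ g 0 0) i with hx
  have hctx : ∀ u ∈ Set.Icc (0 : Fin (k + 1) → ℝ) 1, ∀ i : Fin (k + 1),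
      Ψ.context (addrTask (k + 2) δ g (fun i => u i / 2) 0) (k + 1) i =
        (x i, hat δ (staticPoint (k + 2) (idx i)) (x i) / 2 * u (idx i)) := by
    intro u hu i
    have hq : Ψ.queryPoint (addrTask (k + 2) δ g (fun i => u i / 2) 0) i = x i :=
      hfix.queryPoint_eq (by omega) _ _
    rw [Agent.context_apply, hq]
    have h1 := hτ _ (half_mem hu) (some (idx i))
    rw [hidx, Fin.val_castSucc, hq] at h1
    refine Prod.ext rfl ((addrTask_of_abs_lt (N := k + 2) hN hδ₀ hδ
      (hmaps _ (tent_mem (half_mem hu))).1 0 h1).trans ?_)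
    simp only [Option.elim_some, spikeCenter]
    ring
  obtain ⟨Φ, hsize, hΦ⟩ := hΨ k le_rfl
  obtain ⟨Φ', hsize', hΦ'⟩ := Φ.exists_reparam
    (Fin.append (fun i => (x i : ℝ)) fun _ => 0)
    (Fin.append (fun _ => 0) fun i => hat δ (staticPoint (k + 2) (idx i)) (x i) / 2)
    (Fin.append idx idx) (fun e => by
      refine Fin.addCases (fun i => ?_) (fun i => ?_) e
      · exact Or.inr (Fin.append_left _ _ _)
      · exact Or.inl (Fin.append_right _ _ _))
  refine (hg.hard Φ' (hsize'.trans hsize)).not_gt ?_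
  have hδ6 : ENNReal.ofReal δ < 1 / 6 := by
    have := (enorm_lt_one_sixth_iff δ).mpr (by rw [abs_of_pos hδ₀]; linarith)
    rwa [Real.enorm_eq_ofReal hδ₀.le] at this
  refine lt_of_le_of_lt (iSup₂_le fun u hu => ?_) hδ6
  have hquery : (Ψ.queryPoint (addrTask (k + 2) δ g (fun i => u i / 2) 0) (k + 1) : ℝ) =
      Φ'.eval u 0 := by
    rw [hΦ']
    refine (hΦ _).trans ?_
    congr 1
    funext e
    refine Fin.addCases (fun i => ?_) (fun i => ?_) e
    · simp only [Context.vec, Fin.append_left, hctx u hu]; ring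
    · simp only [Context.vec, Fin.append_right, hctx u hu]; ring
  have h1 := hτ _ (half_mem hu) none
  rw [hlast, Fin.val_last, hquery] at h1
  simp only [spikeCenter, tent_half hu] at h1
  rw [Real.enorm_eq_ofReal_abs]
  exact ENNReal.ofReal_le_ofReal h1.le

end LowerBounds

/-! ### An address map that oscillates in every coordinate -/

/-- The address map `u ↦ 2 / 3 + sin² (2 ^ (m + 1) π ∑ uᵢ) / 3`. In each single coordinate it is a
wave too fast for networks with `m` weights. -/
noncomputable def waveAddress (n m : ℕ) (u : Fin n → ℝ) : ℝ :=
  2 / 3 + 1 / 3 * Real.sin ((∑ i, u i) * 2 ^ (m + 1) * Real.pi) ^ 2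

section Wave

variable {N m : ℕ} {δ : ℝ}

lemma continuous_waveAddress (n m : ℕ) : Continuous (waveAddress n m) := by
  unfold waveAddress
  fun_prop

lemma waveAddress_mem (n m : ℕ) (u : Fin n → ℝ) : waveAddress n m u ∈ Set.Icc (2 / 3 : ℝ) 1 := by
  have h := Real.sin_sq_le_one ((∑ i, u i) * 2 ^ (m + 1) * Real.pi)
  have h' := sq_nonneg (Real.sin ((∑ i, u i) * 2 ^ (m + 1) * Real.pi))
  constructor <;> simp only [waveAddress] <;> linarith

lemma waveAddress_update {n : ℕ} (m : ℕ) (j : Fin n) (t : ℝ) :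
    waveAddress n m (Function.update 0 j t) =
      2 / 3 + 1 / 3 * Real.sin (t * 2 ^ (m + 1) * Real.pi) ^ 2 := by
  simp [waveAddress, Function.update_apply]

lemma update_zero_mem {n : ℕ} (j : Fin n) {t : ℝ} (ht : t ∈ Set.Icc (0 : ℝ) 1) :
    Function.update (0 : Fin n → ℝ) j t ∈ Set.Icc 0 1 := by
  refine ⟨?_, ?_⟩
  · rw [le_update_iff]; exact ⟨ht.1, fun i _ => le_rfl⟩
  · rw [update_le_iff]; exact ⟨ht.2, fun i _ => zero_le_one⟩

lemma isHardAddressMap_waveAddress {n : ℕ} (hn : 0 < n) (m : ℕ) :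
    IsHardAddressMap n m (waveAddress n m) where
  continuousOn := (continuous_waveAddress n m).continuousOn
  image_eq := by
    refine Set.Subset.antisymm (Set.image_subset_iff.mpr fun u _ => waveAddress_mem n m u) ?_
    have hM : (0 : ℝ) < 2 ^ (m + 1) := by positivity
    have hM1 : (1 : ℝ) ≤ 2 ^ (m + 1) := one_le_pow₀ (by norm_num)
    have ht : 1 / (2 * 2 ^ (m + 1)) ∈ Set.Icc (0 : ℝ) 1 := by
      refine ⟨by positivity, ?_⟩
      rw [div_le_one (by positivity)]; linarith
    have h0 : waveAddress n m (Function.update 0 ⟨0, hn⟩ 0) = 2 / 3 := by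
      rw [waveAddress_update]; simp
    have h1 : waveAddress n m (Function.update 0 ⟨0, hn⟩ (1 / (2 * 2 ^ (m + 1)))) = 1 := by
      have : (1 : ℝ) / (2 * 2 ^ (m + 1)) * 2 ^ (m + 1) * Real.pi = Real.pi / 2 := by field_simp
      rw [waveAddress_update, this, Real.sin_pi_div_two]; norm_num
    have := (convex_Icc (0 : Fin n → ℝ) 1).isPreconnected.intermediate_value
      (update_zero_mem ⟨0, hn⟩ (t := 0) (by simp)) (update_zero_mem ⟨0, hn⟩ ht)
      (continuous_waveAddress n m).continuousOn
    rwa [h0, h1] at this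
  hard := by
    intro Φ hΦ
    by_contra! hlt
    refine Φ.not_forall_abs_sub_wave_lt hΦ 0 (Pi.single ⟨0, hn⟩ 1) fun t ht => ?_
    have hu : (0 : Fin n → ℝ) + t • Pi.single ⟨0, hn⟩ 1 =
        Function.update (0 : Fin n → ℝ) ⟨0, hn⟩ t := by
      funext i
      simp [Pi.single_apply, Function.update_apply]
    rw [hu, ← waveAddress_update, ← enorm_lt_one_sixth_iff]
    exact (le_iSup₂ (f := fun (u : Fin n → ℝ) (_ : u ∈ Set.Icc (0 : Fin n → ℝ) 1) =>
      ‖Φ.eval u 0 - waveAddress n m u‖ₑ) _ (update_zero_mem ⟨0, hn⟩ ht)).trans_lt hlt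

/-- For the wave address map, no adaptivity helps. The query that finds the address comes right
after one that reads some coefficient `s j` for the first time; when only `s j` varies, all earlier
samples are constant, so that this query is a small network along a line, while the address is a
fast wave. -/
lemma half_le_worstError_waveAddress (hN : 3 ≤ N) (hδ₀ : 0 < δ) (hδ : δ < 1 / (6 * (N : ℝ)))
    {Ψ : Agent I N} (hΨ : Ψ.QueriesRealizable m) :
    1 / 2 ≤ worstError (addrFamily N δ (waveAddress (N - 1) m)) Ψ.output := by
  by_contra! herr
  set g := waveAddress (N - 1) m with hgdef
  have h18 := lt_one_div_eighteen hN hδ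
  have hhard : IsHardAddressMap (N - 1) m g := isHardAddressMap_waveAddress (by omega) m
  have hmaps : ∀ u ∈ Set.Icc (0 : Fin (N - 1) → ℝ) 1, g u ∈ Set.Icc (2 / 3 : ℝ) 1 :=
    fun u _ => waveAddress_mem _ m u
  obtain ⟨τ, hτ⟩ := exists_schedule hN hδ₀ hδ hhard.continuousOn hmaps hΨ herr
  obtain ⟨k, hk⟩ : ∃ k, (τ none : ℕ) = k + 1 := by
    refine Nat.exists_eq_succ_of_ne_zero fun h0 => ?_
    refine not_forall_queryPoint_eq (Ψ := Ψ) (δ := δ) (i := 0) (by linarith) hhard.image_eq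
      (fun s hs => ?_) Ψ.first fun s => rfl
    have := hτ s hs none
    rwa [h0] at this
  have hkN : k + 2 ≤ N := by have := (τ none).isLt; omega
  obtain ⟨j, hj⟩ : ∃ j, τ (some j) = ⟨k, by omega⟩ := by
    rcases h : τ.symm ⟨k, by omega⟩ with _ | j
    · rw [Equiv.symm_apply_eq, Fin.ext_iff, hk] at h
      exact absurd h (Nat.lt_succ_self k).ne
    · rw [Equiv.symm_apply_eq] at h
      exact ⟨j, h.symm⟩
  -- the coefficients on the line are halved, since `tent` doubles them
  set f : ℝ → I → ℝ := fun t => addrTask N δ g (Function.update 0 j (t / 2)) 0 with hf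
  have hf_apply : ∀ t x, f t x = t / 2 * hat δ (staticPoint N j) x := by
    intro t x
    simp [hf, addrTask_zero_apply, Function.update_apply]
  have hfar : ∀ i < k, δ ≤ |(Ψ.queryPoint (f 0) i : ℝ) - staticPoint N j| := by
    intro i hi
    by_contra! hlt
    have h0 := update_zero_mem j (t := 0 / 2) (by simp)
    have h1 := hτ _ h0 (τ.symm ⟨i, by omega⟩)
    rw [Equiv.apply_symm_apply] at h1
    have h2 := (spikeSeparated hN hδ (hmaps _ (tent_mem h0)).1).eq_of_abs_lt h1
      (o' := some j) hlt.le
    rw [Equiv.symm_apply_eq, hj, Fin.mk.injEq] at h2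
    omega
  have hctx : ∀ t, Ψ.context (f t) k = Ψ.context (f 0) k := by
    intro t
    refine (Ψ.context_congr fun i hi => ?_).symm
    rw [hf_apply, hf_apply, hat_eq_zero hδ₀ (hfar i hi), mul_zero, mul_zero]
  set x : I := Ψ.queryPoint (f 0) k with hx
  have hqx : ∀ t, Ψ.queryPoint (f t) k = x := by
    intro t
    rw [hx, Agent.queryPoint, hctx]; rfl
  obtain ⟨Φ, hsize, hΦ⟩ := hΨ k hkN
  have hvec : ∀ t, (Ψ.context (f t) (k + 1)).vec = (Ψ.context (f 0) (k + 1)).vec +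
      t • Fin.append 0 (Fin.snoc (α := fun _ => ℝ) 0 (hat δ (staticPoint N j) x / 2)) := by
    intro t
    funext e
    rw [Agent.context_succ, Agent.context_succ, hqx, hqx, hctx, hf_apply, hf_apply]
    refine Fin.addCases (fun i => ?_) (fun i => ?_) e
    · refine Fin.lastCases ?_ (fun i => ?_) i <;>
        simp only [Context.vec, Pi.add_apply, Pi.smul_apply, Fin.append_left, Fin.snoc_last,
          Fin.snoc_castSucc, Pi.zero_apply, smul_zero, add_zero]
    · refine Fin.lastCases ?_ (fun i => ?_) i <;>
        simp only [Context.vec, Pi.add_apply, Pi.smul_apply, Fin.append_right, Fin.snoc_last,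
          Fin.snoc_castSucc, Pi.zero_apply, smul_eq_mul, mul_zero, add_zero]
      ring
  refine Φ.not_forall_abs_sub_wave_lt hsize (Ψ.context (f 0) (k + 1)).vec
    (Fin.append 0 (Fin.snoc (α := fun _ => ℝ) 0 (hat δ (staticPoint N j) x / 2)))
    fun t ht => ?_
  rw [← hvec, ← hΦ]
  have hs : (fun i => Function.update (0 : Fin (N - 1) → ℝ) j t i / 2) =
      Function.update (0 : Fin (N - 1) → ℝ) j (t / 2) := by
    funext i
    by_cases hij : i = j
    · subst hij; simp
    · simp [Function.update_of_ne hij]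
  have hmem := update_zero_mem j ht
  have h1 := hτ _ (half_mem hmem) none
  simp only [spikeCenter] at h1
  rw [tent_half hmem, hk, hs, hgdef, waveAddress_update] at h1
  exact h1.trans (by linarith)

end Wave

/-! ### Comparison of the regimes -/

theorem theorem3 (N m : ℕ) (hN : 3 ≤ N) (δ : ℝ) (hδ₀ : 0 < δ) (hδ : δ < 1 / (6 * (N : ℝ))) :
    (∀ g : (Fin (N - 1) → ℝ) → ℝ, IsHardAddressMap (N - 1) m g →
      (∃ Ψ : Agent unitInterval N, Ψ.FixedButLast ∧
        ∀ f ∈ addrFamily N δ g, Ψ.output f = f) ∧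
      (∀ Ψ : ICLearner unitInterval N, 1 / 2 ≤ worstError (addrFamily N δ g) Ψ.output) ∧
      (∀ Ψ : Agent unitInterval N, Ψ.FixedButLast → Ψ.QueriesRealizable m →
        1 / 2 ≤ worstError (addrFamily N δ g) Ψ.output) ∧
      RegimeLT (addrFamily N δ g) (ICG N) (AG N)) ∧
    (∃ g : (Fin (N - 1) → ℝ) → ℝ, IsHardAddressMap (N - 1) m g ∧
      (∀ Ψ : Agent unitInterval N, Ψ.QueriesRealizable m →
        1 / 2 ≤ worstError (addrFamily N δ g) Ψ.output) ∧
      RegimeEq (addrFamily N δ g) (ICR N m) (AR N m)) := by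
  refine ⟨fun g hg => ?_, waveAddress (N - 1) m, isHardAddressMap_waveAddress (by omega) m,
    fun Ψ hΨ => half_le_worstError_waveAddress hN hδ₀ hδ hΨ, ?_⟩
  · have hIC := half_le_worstError_ICLearner hN hδ₀ hδ hg.image_eq
    have hmaps : ∀ u ∈ Set.Icc (0 : Fin (N - 1) → ℝ) 1, g u ∈ Set.Icc (2 / 3 : ℝ) 1 :=
      fun u hu => hg.image_eq ▸ Set.mem_image_of_mem g hu
    obtain ⟨Ψ, hfix, hexact⟩ : ∃ Ψ : Agent unitInterval N, Ψ.FixedButLast ∧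
        ∀ f ∈ addrFamily N δ g, Ψ.output f = f := by
      obtain ⟨k, rfl⟩ : ∃ k, N = k + 2 := ⟨N - 2, by omega⟩
      exact ⟨exactAgent k hN δ g, exactAgent_fixedButLast k hN g,
        fun f hf => exactAgent_output hN hδ₀ hδ hmaps hf⟩
    have hzero : worstError (addrFamily N δ g) Ψ.output = 0 := by
      refine le_antisymm (iSup₂_le fun f hf => iSup_le fun x => ?_) zero_le
      rw [hexact f hf, sub_self, enorm_zero]
    refine ⟨⟨Ψ, hfix, hexact⟩, hIC,
      fun Ψ hfix hΨ => half_le_worstError_of_fixedButLast hN hδ₀ hδ hg hfix hΨ, ?_, ?_⟩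
    · exact fun P _ => ⟨Ψ.output, ⟨Ψ, rfl⟩, hzero.trans_le zero_le⟩
    · intro hle
      obtain ⟨P, ⟨Ψ', rfl⟩, hP⟩ := hle Ψ.output ⟨Ψ, rfl⟩
      have h := (hIC Ψ').trans hP
      rw [hzero] at h
      exact absurd h (by simp)
  · rcases Nat.eq_zero_or_pos m with rfl | hm
    · -- without weights, the only predictor of either kind is zero
      have hsize : (ReLUNet.const (N + N + 1) 0).size ≤ 0 := (ReLUNet.size_const_zero _).le
      constructor
      · rintro P ⟨Ψ, hΨ, rfl⟩
        refine ⟨_, const_mem_AR hsize, le_of_eq ?_⟩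
        unfold ICLearner.output
        rw [hΨ.eq_zero]
      · rintro P ⟨Ψ, -, hΨ, rfl⟩
        refine ⟨_, const_mem_ICR hsize, le_of_eq ?_⟩
        unfold Agent.output
        rw [hΨ.eq_zero]
    · -- the constant `1 / 2` attains the lower bound in both regimes
      have hsize : (ReLUNet.const (N + N + 1) (1 / 2)).size ≤ m :=
        (ReLUNet.size_const_le _ _).trans hm
      have hhalf : worstError (addrFamily N δ (waveAddress (N - 1) m)) (fun _ _ => 1 / 2) ≤
          1 / 2 := by
        refine worstError_const_half_le ?_
        rintro f ⟨s, hs, β, hβ, rfl⟩ x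
        exact addrTask_mem_Icc hN hδ₀ hδ hs (waveAddress_mem _ m _).1 hβ x
      constructor
      · rintro P ⟨Ψ, -, rfl⟩
        exact ⟨_, const_mem_AR hsize, hhalf.trans (half_le_worstError_ICLearner hN hδ₀ hδ
          (isHardAddressMap_waveAddress (by omega) m).image_eq Ψ)⟩
      · rintro P ⟨Ψ, hΨ, -, rfl⟩
        exact ⟨_, const_mem_ICR hsize,
          hhalf.trans (half_le_worstError_waveAddress hN hδ₀ hδ hΨ)⟩
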